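/- Assume the Riemann Hypothesis. Let $\zeta$ be the Riemann zeta function and, for $0<\varepsilon\le 1/2$, consider the meromorphic function $s\mapsto \zeta(s)/\zeta(s+\varepsilon)$ (which vanishes at $s=1-\varepsilon$, where $\zeta(s+\varepsilon)$ has its pole). There are absolute constants $C_1,C_2,C_3>0$ such that for every $\varepsilon$ with $0<\varepsilon\le 1/2$: (i) for all $s\in\mathbb{C}$ with $\Re s=1/2$, $$\left|\frac{\zeta(s)}{\zeta(s+\varepsilon)}\right|^2\le C_1\,|s|^{\varepsilon};$$ (ii) for all $s\in\mathbb{C}$ with $\Re s=1/2$, $$\left|\frac{\zeta(s)}{\zeta(s+\varepsilon)}\right|^2\le 1+C_2\,\varepsilon\,|s|^{1/2};$$ (iii) for all $s\in\mathbb{C}$ with $\Re s\ge 1/2$ and $s\ne 1$, $$\left|\frac{\zeta(s)/\zeta(s+\varepsilon)}{s(1-s)}\right|\le C_3\,\frac{|s|^{\varepsilon/2}}{|s-1|^2}.$$ -/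

import Mathlib

/-- The value at `s` of the meromorphic function `s ↦ ζ(s) / ζ(s + ε)`. At `s = 1 - ε` the
denominator has its pole, so the quotient takes the value `0` there (for `ε ≠ 0`); this has to be
said separately because `riemannZeta 1` is a finite default value. -/
noncomputable def zetaQuotient (ε : ℝ) (s : ℂ) : ℂ :=
  if s + (ε : ℂ) = 1 then 0 else riemannZeta s / riemannZeta (s + (ε : ℂ))

/-!
Under the Riemann hypothesis `ξ(s) = s (s - 1) π ^ (-s / 2) Γ(s / 2) ζ(s)` has no zeros to the right
of the critical line. The functional equation and the reflection principle give
`|ξ(s)| = |ξ(s + ε)|` on the line `Re s = (1 - ε) / 2`, so the Phragmén–Lindelöf principle yields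
`|ξ(s)| ≤ |ξ(s + ε)|` everywhere to the right of it. The growth condition this needs is a lower
bound for `|ξ|`: the zero-free `ξ` has a logarithm on a disc around `3 + it`, to which the
Borel–Carathéodory inequality applies. Thus `ζ(s) / ζ(s + ε)` is controlled by the remaining ratio
of Gamma factors, which is at most `(K |s|) ^ (ε / 2)` uniformly in `ε`: compare the factors of
Euler's limit formula one by one with Bernoulli's inequality.
-/

open Complex Filter Topology MeasureTheory Set ComplexConjugate

/-! ### Elementary inequalities -/

lemma sq_norm_add_ofReal (w : ℂ) (x : ℝ) : ‖w + x‖ ^ 2 = ‖w‖ ^ 2 + 2 * x * w.re + x ^ 2 := by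
  simp only [Complex.sq_norm, normSq_apply, add_re, add_im, ofReal_re, ofReal_im]
  ring

lemma norm_le_norm_add_ofReal {s : ℂ} {x : ℝ} (hs : 0 ≤ s.re) (hx : 0 ≤ x) :
    ‖s‖ ≤ ‖s + x‖ := by
  rw [← pow_le_pow_iff_left₀ (norm_nonneg _) (norm_nonneg _) two_ne_zero, sq_norm_add_ofReal]
  nlinarith [mul_nonneg hx hs]

lemma re_mem_Ioo_of_mem_ball {c z : ℂ} {R : ℝ} (hz : z ∈ Metric.ball c R) :
    z.re ∈ Ioo (c.re - R) (c.re + R) := by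
  have := abs_lt.1 ((abs_re_le_norm (z - c)).trans_lt (mem_ball_iff_norm.1 hz))
  rw [sub_re] at this
  constructor <;> linarith

lemma mul_rpow_le_mul_rpow {K x p : ℝ} (hK : 1 ≤ K) (hx : 0 ≤ x) (hp : p ≤ 1) :
    (K * x) ^ p ≤ K * x ^ p := by
  rw [Real.mul_rpow (by linarith) hx]
  grw [Real.rpow_le_self_of_one_le hK hp]

lemma rpow_le_one_add_div_mul_rpow {x r p : ℝ} (hx : 0 ≤ x) (hr : 0 < r) (hrp : r ≤ p) :
    x ^ r ≤ 1 + r / p * x ^ p := by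
  have hp : 0 < p := hr.trans_le hrp
  have hr1 : r / p ≤ 1 := (div_le_one hp).2 hrp
  have hr0 : 0 ≤ r / p := by positivity
  have amgm := Real.geom_mean_le_arith_mean2_weighted (p₁ := 1) (p₂ := x ^ p)
    (sub_nonneg.2 hr1) hr0 zero_le_one (by positivity) (by ring)
  rw [Real.one_rpow, one_mul, ← Real.rpow_mul hx, mul_div_cancel₀ r hp.ne'] at amgm
  linarith

/-! ### Zero-free functions on a disc and bounded functions on a half-plane -/

lemma exists_eq_mul_exp_of_forall_ball_ne_zero {f : ℂ → ℂ} {c : ℂ} {R : ℝ} (hR : 0 < R)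
    (hf : DifferentiableOn ℂ f (Metric.ball c R)) (hf0 : ∀ z ∈ Metric.ball c R, f z ≠ 0) :
    ∃ g : ℂ → ℂ, DifferentiableOn ℂ g (Metric.ball c R) ∧ g c = 0 ∧
      ∀ z ∈ Metric.ball c R, f z = f c * exp (g z) := by
  have hlog : DifferentiableOn ℂ (fun z ↦ deriv f z / f z) (Metric.ball c R) :=
    (hf.deriv Metric.isOpen_ball).div hf hf0
  obtain ⟨g, hgc, hg⟩ := hlog.isExactOn_ball.with_val_at c 0
  have hderiv : ∀ z ∈ Metric.ball c R, HasDerivAt (fun z ↦ f z * exp (-g z)) 0 z := by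
    intro z hz
    have hfz := (hf.differentiableAt (Metric.isOpen_ball.mem_nhds hz)).hasDerivAt
    convert! hfz.mul (hg z hz).neg.cexp using 1
    field_simp [hf0 z hz]
    simp
  refine ⟨g, fun z hz ↦ (hg z hz).differentiableAt.differentiableWithinAt, hgc, fun z hz ↦ ?_⟩
  have hconst := Metric.isOpen_ball.is_const_of_deriv_eq_zero (convex_ball c R).isPreconnected
    (fun y hy ↦ (hderiv y hy).differentiableAt.differentiableWithinAt)
    (fun y hy ↦ (hderiv y hy).deriv) hz (Metric.mem_ball_self hR)
  simp only [hgc, neg_zero, exp_zero, mul_one] at hconst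
  rw [← hconst, mul_assoc, ← exp_add, neg_add_cancel, exp_zero, mul_one]

theorem norm_mul_exp_neg_le_of_forall_ball_ne_zero {f : ℂ → ℂ} {c w : ℂ} {R r L : ℝ}
    (hf : DifferentiableOn ℂ f (Metric.ball c R)) (hf0 : ∀ z ∈ Metric.ball c R, f z ≠ 0)
    (hL : 0 < L) (hfL : ∀ z ∈ Metric.ball c R, ‖f z‖ ≤ ‖f c‖ * Real.exp L)
    (hrR : r < R) (hw : ‖w - c‖ ≤ r) :
    ‖f c‖ * Real.exp (-(2 * L * r / (R - r))) ≤ ‖f w‖ := by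
  have hR : 0 < R := ((norm_nonneg _).trans hw).trans_lt hrR
  have hfc : 0 < ‖f c‖ := norm_pos_iff.2 (hf0 c (Metric.mem_ball_self hR))
  obtain ⟨g, hg, hgc, hfg⟩ := exists_eq_mul_exp_of_forall_ball_ne_zero hR hf hf0
  have hmaps : MapsTo (· + c) (Metric.ball 0 R) (Metric.ball c R) := fun z hz ↦ by
    simpa [mem_ball_iff_norm] using hz
  have hgre : MapsTo (fun z ↦ g (z + c)) (Metric.ball 0 R) {z | z.re ≤ L} := fun z hz ↦ by
    have h := hfL _ (hmaps hz)
    rw [hfg _ (hmaps hz), norm_mul, norm_exp] at h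
    exact Real.exp_le_exp.1 (le_of_mul_le_mul_left h hfc)
  have hgw := borelCaratheodory_zero (z := w - c) hL
    (hg.comp (by fun_prop) hmaps) hgre hR
    (by rw [mem_ball_zero_iff]; linarith) (by simpa using hgc)
  rw [Function.comp_apply, sub_add_cancel] at hgw
  have hgr : ‖g w‖ ≤ 2 * L * r / (R - r) := by
    have hr : 0 ≤ r := (norm_nonneg _).trans hw
    have : 0 < R - r := sub_pos.2 hrR
    exact hgw.trans (by gcongr)
  rw [hfg w (by rw [mem_ball_iff_norm]; linarith), norm_mul, norm_exp]
  gcongr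
  linarith [(abs_le.1 (abs_re_le_norm (g w))).1]

theorem norm_le_of_norm_le_exp_of_re_eq {f : ℂ → ℂ} {a b A B C D : ℝ}
    (hf : ∀ z, a ≤ z.re → DifferentiableAt ℂ f z)
    (hexp : ∀ z, a ≤ z.re → ‖f z‖ ≤ A * Real.exp (B * ‖z‖))
    (hright : ∀ z, b ≤ z.re → ‖f z‖ ≤ D) (hline : ∀ z, z.re = a → ‖f z‖ ≤ C) {z : ℂ}
    (hz : a ≤ z.re) : ‖f z‖ ≤ C := by
  have hA : 0 ≤ A :=
    nonneg_of_mul_nonneg_left ((norm_nonneg _).trans (hexp z hz)) (Real.exp_pos _)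
  have hdiff : DiffContOnCl ℂ (fun z ↦ f (z + a)) {z | 0 < z.re} := by
    refine DifferentiableOn.diffContOnCl fun z hz ↦ DifferentiableAt.differentiableWithinAt ?_
    rw [closure_setOfPred_lt_re] at hz
    exact (hf (z + a) (by simpa using hz)).comp z (f := (· + (a : ℂ))) (by fun_prop)
  have hgrowth : (fun z ↦ f (z + a)) =O[Bornology.cobounded ℂ ⊓ 𝓟 {z | 0 < z.re}]
      fun z ↦ Real.exp (|B| * ‖z‖ ^ (1 : ℝ)) := by
    refine Asymptotics.IsBigO.of_bound (A * Real.exp (|B| * |a|))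
      (eventually_inf_principal.2 (Eventually.of_forall fun z (hz : 0 < z.re) ↦ ?_))
    have hza : ‖z + a‖ ≤ |a| + ‖z‖ := by
      grw [norm_add_le, norm_real, Real.norm_eq_abs, add_comm]
    rw [Real.rpow_one, Real.norm_of_nonneg (Real.exp_pos _).le, mul_assoc, ← Real.exp_add,
      ← mul_add]
    grw [hexp (z + a) (by simpa using hz.le), le_abs_self B, hza]
  have hreal : IsBoundedUnder (· ≤ ·) atTop fun x : ℝ ↦ ‖f (x + a)‖ := by
    refine isBoundedUnder_of_eventually_le (a := D) ?_
    filter_upwards [eventually_ge_atTop (b - a)] with x hx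
    exact hright _ (by simpa using hx)
  simpa using PhragmenLindelof.right_half_plane_of_bounded_on_real hdiff
    ⟨1, one_lt_two, |B|, hgrowth⟩ hreal (fun x ↦ hline (x * I + a) (by simp)) (z := z - a)
    (by simpa using hz)

/-! ### Ratios of Gamma factors -/

lemma norm_mul_rpow_norm_add_one_div_le {w : ℂ} {δ c : ℝ} (hδ0 : 0 ≤ δ) (hδ1 : δ ≤ 1)
    (hc : 0 < c) (hw : c ≤ w.re) :
    ‖w‖ * (‖w + 1‖ / ‖w‖) ^ δ ≤ ‖w + δ‖ * Real.exp (δ / c ^ 2) := by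
  have hw0 : 0 < ‖w‖ := (hc.trans_le hw).trans_le (re_le_norm w)
  have hwδ : c ≤ ‖w + δ‖ := le_trans (by simpa using by linarith) (re_le_norm _)
  have hexp : 1 + δ / c ^ 2 ≤ Real.exp (δ / c ^ 2) := by
    linarith [Real.add_one_le_exp (δ / c ^ 2)]
  set ρ := ‖w + 1‖ / ‖w‖ with hρ
  have bernoulli : (ρ ^ 2) ^ δ ≤ 1 + δ * (ρ ^ 2 - 1) := by
    have := rpow_one_add_le_one_add_mul_self (s := ρ ^ 2 - 1)
      (by linarith [sq_nonneg ρ]) hδ0 hδ1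
    rwa [add_sub_cancel] at this
  have interpolation : ‖w‖ ^ 2 * (1 + δ * (ρ ^ 2 - 1)) = ‖w + δ‖ ^ 2 + δ * (1 - δ) := by
    have h1 := sq_norm_add_ofReal w 1
    rw [ofReal_one] at h1
    rw [sq_norm_add_ofReal w δ, hρ, div_pow, h1]
    field_simp
    ring
  refine le_of_sq_le_sq ?_ (by positivity)
  calc (‖w‖ * ρ ^ δ) ^ 2 = ‖w‖ ^ 2 * (ρ ^ 2) ^ δ := by
        rw [mul_pow, ← Real.rpow_natCast_mul (by positivity),
          ← Real.rpow_mul_natCast (by positivity), mul_comm δ]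
    _ ≤ ‖w + δ‖ ^ 2 + δ * (1 - δ) := interpolation ▸ by gcongr
    _ ≤ ‖w + δ‖ ^ 2 + δ / c ^ 2 * c ^ 2 := by
        rw [div_mul_cancel₀ _ (by positivity)]
        nlinarith
    _ ≤ ‖w + δ‖ ^ 2 + δ / c ^ 2 * ‖w + δ‖ ^ 2 := by gcongr
    _ = ‖w + δ‖ ^ 2 * (1 + δ / c ^ 2) := by ring
    _ ≤ ‖w + δ‖ ^ 2 * (1 + δ / c ^ 2) ^ 2 := by
        gcongr
        exact le_self_pow₀ (le_add_of_nonneg_right (by positivity)) two_ne_zero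
    _ ≤ (‖w + δ‖ * Real.exp (δ / c ^ 2)) ^ 2 := by rw [mul_pow]; gcongr

lemma norm_add_natCast_pos {z : ℂ} (hz : 0 < z.re) (j : ℕ) : 0 < ‖z + j‖ :=
  lt_of_lt_of_le (by simpa using by positivity) (re_le_norm (z + j))

lemma norm_prod_add_mul_rpow_le {z : ℂ} {δ a : ℝ} (hδ0 : 0 ≤ δ) (hδ1 : δ ≤ 1) (ha : 0 < a)
    (hz : a ≤ z.re) (n : ℕ) :
    ‖∏ j ∈ Finset.range n, (z + j)‖ * (‖z + n‖ / ‖z‖) ^ δ ≤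
      ‖∏ j ∈ Finset.range n, (z + δ + j)‖ *
        Real.exp (δ * ∑ j ∈ Finset.range n, 1 / (j + a) ^ 2) := by
  have hpos := norm_add_natCast_pos (ha.trans_le hz)
  have hz0 : 0 < ‖z‖ := by simpa using hpos 0
  induction n with
  | zero => simp [hz0.ne']
  | succ n ih =>
    have hstep := norm_mul_rpow_norm_add_one_div_le (w := z + n) (c := n + a) hδ0 hδ1
      (by positivity) (by simpa [add_comm] using hz)
    have htelescope : ‖z + ((n + 1 : ℕ) : ℂ)‖ / ‖z‖ =
        ‖z + n‖ / ‖z‖ * (‖z + n + 1‖ / ‖z + n‖) := by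
      rw [Nat.cast_add_one, ← add_assoc]
      field_simp [(hpos n).ne']
    rw [Finset.prod_range_succ, Finset.prod_range_succ, Finset.sum_range_succ, norm_mul, norm_mul,
      htelescope, Real.mul_rpow (by positivity) (by positivity), mul_add, Real.exp_add,
      mul_mul_mul_comm _ ‖z + n‖, mul_mul_mul_comm _ ‖z + δ + n‖, add_right_comm z (δ : ℂ),
      mul_one_div]
    exact mul_le_mul ih hstep (by positivity) (by positivity)

lemma summable_one_div_nat_add_sq (a : ℝ) : Summable fun j : ℕ ↦ 1 / (j + a) ^ 2 := by
  simpa using (Real.summable_one_div_nat_add_rpow a 2).2 one_lt_two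

lemma norm_GammaSeq_add_le {z : ℂ} {δ a : ℝ} (hδ0 : 0 ≤ δ) (hδ1 : δ ≤ 1) (ha : 0 < a)
    (hz : a ≤ z.re) {n : ℕ} (hn : n ≠ 0) :
    ‖GammaSeq (z + δ) n‖ ≤
      (Real.exp (∑' j : ℕ, 1 / (j + a) ^ 2) * ‖z‖) ^ δ * ‖GammaSeq z n‖ := by
  set S := ∑' j : ℕ, 1 / (j + a) ^ 2
  set P := ‖∏ j ∈ Finset.range (n + 1), (z + j)‖ with hP
  set Q := ‖∏ j ∈ Finset.range (n + 1), (z + δ + j)‖ with hQ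
  have hz0 : 0 < z.re := ha.trans_le hz
  have hP0 : 0 < P := by
    rw [hP, norm_prod]
    exact Finset.prod_pos fun j _ ↦ norm_add_natCast_pos hz0 j
  have hQ0 : 0 < Q := by
    rw [hQ, norm_prod]
    exact Finset.prod_pos fun j _ ↦ norm_add_natCast_pos (by simpa using by positivity) j
  have hnz : (n : ℝ) ≤ ‖z + (n + 1 : ℕ)‖ :=
    le_trans (by simpa using by linarith) (re_le_norm _)
  have hsum : ∑ j ∈ Finset.range (n + 1), 1 / (j + a) ^ 2 ≤ S :=
    (summable_one_div_nat_add_sq a).sum_le_tsum _ fun j _ ↦ by positivity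
  have hprod : P * (n : ℝ) ^ δ ≤ Q * (Real.exp S * ‖z‖) ^ δ := by
    have hnorm : 0 < ‖z‖ := hz0.trans_le (re_le_norm z)
    have h : P * ((n : ℝ) / ‖z‖) ^ δ ≤ Q * Real.exp (δ * S) :=
      le_trans (by gcongr) ((norm_prod_add_mul_rpow_le hδ0 hδ1 ha hz (n + 1)).trans (by gcongr))
    rw [Real.div_rpow (by positivity) hnorm.le, mul_div_assoc', div_le_iff₀ (by positivity)] at h
    rwa [Real.mul_rpow (by positivity) hnorm.le, ← Real.exp_mul, mul_comm S, ← mul_assoc]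
  have hpow : ‖(n : ℂ) ^ (z + δ)‖ = ‖(n : ℂ) ^ z‖ * (n : ℝ) ^ δ := by
    rw [cpow_add _ _ (Nat.cast_ne_zero.2 hn), norm_mul, norm_natCast_cpow_of_pos hn.bot_lt (δ : ℂ),
      ofReal_re]
  simp only [GammaSeq, norm_div, norm_mul, hpow, ← hP, ← hQ]
  rw [div_le_iff₀ hQ0, mul_div_assoc', div_mul_eq_mul_div, le_div_iff₀ hP0]
  calc ‖(n : ℂ) ^ z‖ * (n : ℝ) ^ δ * ‖(n.factorial : ℂ)‖ * P
      = ‖(n : ℂ) ^ z‖ * ‖(n.factorial : ℂ)‖ * (P * (n : ℝ) ^ δ) := by ring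
    _ ≤ ‖(n : ℂ) ^ z‖ * ‖(n.factorial : ℂ)‖ * (Q * (Real.exp S * ‖z‖) ^ δ) := by gcongr
    _ = _ := by ring

theorem exists_norm_Gamma_add_le_rpow_mul {a : ℝ} (ha : 0 < a) :
    ∃ K : ℝ, 0 < K ∧ ∀ (z : ℂ) (δ : ℝ), a ≤ z.re → 0 ≤ δ → δ ≤ 1 →
      ‖Gamma (z + δ)‖ ≤ (K * ‖z‖) ^ δ * ‖Gamma z‖ := by
  refine ⟨_, Real.exp_pos (∑' j : ℕ, 1 / (j + a) ^ 2), fun z δ hz hδ0 hδ1 ↦ ?_⟩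
  refine le_of_tendsto_of_tendsto (GammaSeq_tendsto_Gamma (z + δ)).norm
    ((GammaSeq_tendsto_Gamma z).norm.const_mul _) ?_
  filter_upwards [eventually_ne_atTop 0] with n hn using norm_GammaSeq_add_le hδ0 hδ1 ha hz hn

theorem exists_norm_Gamma_le_mul_norm_Gamma_add {a : ℝ} (ha : 0 < a) :
    ∃ D : ℝ, 0 < D ∧ ∀ (z : ℂ) (δ : ℝ), a ≤ z.re → 0 ≤ δ → δ ≤ 1 →
      ‖Gamma z‖ ≤ D * ‖Gamma (z + δ)‖ := by
  obtain ⟨K, hK0, hK⟩ := exists_norm_Gamma_add_le_rpow_mul ha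
  have hK' : 0 < K * (1 + 1 / a) + 1 / a := by positivity
  refine ⟨_, hK', fun z δ hz hδ0 hδ1 ↦ ?_⟩
  have haz : a ≤ ‖z‖ := hz.trans (re_le_norm z)
  have hz0 : 0 < ‖z‖ := ha.trans_le haz
  have hinv : 1 ≤ 1 / a * ‖z‖ := by rwa [one_div_mul_eq_div, one_le_div ha]
  have hnorm : ‖z + δ‖ ≤ ‖z‖ + 1 := by
    refine (norm_add_le _ _).trans ?_
    rw [norm_real, Real.norm_of_nonneg hδ0]
    gcongr
  have hle : K * ‖z + δ‖ ≤ (K * (1 + 1 / a) + 1 / a) * ‖z‖ := by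
    have := mul_le_mul_of_nonneg_left (hnorm.trans (add_le_add_right hinv ‖z‖)) hK0.le
    nlinarith
  have hone : 1 ≤ (K * (1 + 1 / a) + 1 / a) * ‖z‖ := by
    nlinarith [show 0 ≤ K * (1 + 1 / a) * ‖z‖ by positivity]
  -- The remaining step from `z + δ` to `z + 1` has length `1 - δ`, and `Γ (z + 1) = z * Γ z`.
  refine le_of_mul_le_mul_left ?_ hz0
  calc ‖z‖ * ‖Gamma z‖ = ‖Gamma (z + δ + (1 - δ : ℝ))‖ := by
        rw [← norm_mul, ← Gamma_add_one z (norm_pos_iff.1 hz0)]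
        push_cast
        ring_nf
    _ ≤ (K * ‖z + δ‖) ^ (1 - δ) * ‖Gamma (z + δ)‖ :=
        hK _ _ (by simpa using by linarith) (by linarith) (by linarith)
    _ ≤ ((K * (1 + 1 / a) + 1 / a) * ‖z‖) ^ (1 - δ) * ‖Gamma (z + δ)‖ := by
        gcongr
    _ ≤ (K * (1 + 1 / a) + 1 / a) * ‖z‖ * ‖Gamma (z + δ)‖ := by
        gcongr
        exact Real.rpow_le_self_of_one_le hone (by linarith)
    _ = ‖z‖ * ((K * (1 + 1 / a) + 1 / a) * ‖Gamma (z + δ)‖) := by ring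

lemma norm_Gammaℝ (s : ℂ) : ‖Gammaℝ s‖ = Real.pi ^ (-s.re / 2) * ‖Gamma (s / 2)‖ := by
  rw [Gammaℝ_def, norm_mul, norm_cpow_eq_rpow_re_of_pos Real.pi_pos, div_ofNat_re, neg_re]

lemma norm_Gammaℝ_add_ofReal (s : ℂ) (ε : ℝ) :
    ‖Gammaℝ (s + ε)‖ =
      Real.pi ^ (-(ε / 2)) * (Real.pi ^ (-s.re / 2) * ‖Gamma (s / 2 + (ε / 2 : ℝ))‖) := by
  rw [norm_Gammaℝ, ← mul_assoc, ← Real.rpow_add Real.pi_pos]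
  congr 2
  · simp only [add_re, ofReal_re]
    ring
  · push_cast
    ring_nf

theorem exists_norm_Gammaℝ_add_le_rpow_mul {a : ℝ} (ha : 0 < a) :
    ∃ K : ℝ, 0 < K ∧ ∀ (s : ℂ) (ε : ℝ), a ≤ s.re → 0 ≤ ε → ε ≤ 2 →
      ‖Gammaℝ (s + ε)‖ ≤ (K * ‖s‖) ^ (ε / 2) * ‖Gammaℝ s‖ := by
  obtain ⟨K, hK0, hK⟩ := exists_norm_Gamma_add_le_rpow_mul (half_pos ha)
  refine ⟨K / 2, by positivity, fun s ε hs hε0 hε2 ↦ ?_⟩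
  have hΓ := hK (s / 2) (ε / 2) (by simpa using by linarith) (by linarith) (by linarith)
  rw [norm_div, Complex.norm_ofNat, mul_div_assoc', ← div_mul_eq_mul_div] at hΓ
  have hπ : Real.pi ^ (-(ε / 2)) ≤ 1 :=
    Real.rpow_le_one_of_one_le_of_nonpos (by linarith [Real.pi_gt_three]) (by linarith)
  rw [norm_Gammaℝ_add_ofReal, norm_Gammaℝ, mul_left_comm ((K / 2 * ‖s‖) ^ (ε / 2))]
  exact (mul_le_of_le_one_left (by positivity) hπ).trans (by gcongr)

theorem exists_norm_Gammaℝ_le_mul_norm_Gammaℝ_add {a : ℝ} (ha : 0 < a) :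
    ∃ D : ℝ, 0 < D ∧ ∀ (s : ℂ) (ε : ℝ), a ≤ s.re → 0 ≤ ε → ε ≤ 2 →
      ‖Gammaℝ s‖ ≤ D * ‖Gammaℝ (s + ε)‖ := by
  obtain ⟨D, hD0, hD⟩ := exists_norm_Gamma_le_mul_norm_Gamma_add (half_pos ha)
  refine ⟨Real.pi * D, by positivity, fun s ε hs hε0 hε2 ↦ ?_⟩
  have hΓ := hD (s / 2) (ε / 2) (by simpa using by linarith) (by linarith) (by linarith)
  have hπ : 1 ≤ Real.pi * Real.pi ^ (-(ε / 2)) := by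
    rw [mul_comm, ← Real.rpow_add_one Real.pi_pos.ne']
    exact Real.one_le_rpow (by linarith [Real.pi_gt_three]) (by linarith)
  rw [norm_Gammaℝ_add_ofReal, norm_Gammaℝ]
  calc Real.pi ^ (-s.re / 2) * ‖Gamma (s / 2)‖
      ≤ Real.pi ^ (-s.re / 2) * (D * ‖Gamma (s / 2 + (ε / 2 : ℝ))‖) := by gcongr
    _ ≤ Real.pi * Real.pi ^ (-(ε / 2)) *
          (Real.pi ^ (-s.re / 2) * (D * ‖Gamma (s / 2 + (ε / 2 : ℝ))‖)) :=
        le_mul_of_one_le_left (by positivity) hπ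
    _ = _ := by ring

lemma Gammaℝ_conj (s : ℂ) : Gammaℝ (conj s) = conj (Gammaℝ s) := by
  have hpi : (Real.pi : ℂ).arg ≠ Real.pi := by
    rw [arg_ofReal_of_nonneg Real.pi_pos.le]
    exact Real.pi_pos.ne
  have hpow := cpow_conj (Real.pi : ℂ) (-s / 2) hpi
  rw [conj_ofReal, map_div₀, map_neg, map_ofNat] at hpow
  rw [Gammaℝ_def, Gammaℝ_def, map_mul, ← Gamma_conj, map_div₀, map_ofNat, hpow]

lemma sq_norm_Gammaℝ_one_add_mul_I (t : ℝ) :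
    ‖Gammaℝ (1 + t * I)‖ ^ 2 = (Real.cosh (Real.pi * t / 2))⁻¹ := by
  have hconj : 1 - t * I = conj (1 + t * I) := by simp [sub_eq_add_neg]
  have hcos : cos (Real.pi * (t * I) / 2) = Real.cosh (Real.pi * t / 2) := by
    rw [ofReal_cosh, ← cos_mul_I]
    push_cast
    ring_nf
  have h := Gammaℝ_one_sub_mul_Gammaℝ_one_add (t * I)
  rw [hconj, Gammaℝ_conj, conj_mul', hcos] at h
  exact_mod_cast h

lemma exp_neg_abs_le_norm_Gammaℝ_one_add_mul_I (t : ℝ) :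
    Real.exp (-|t|) ≤ ‖Gammaℝ (1 + t * I)‖ := by
  have habs : |Real.pi * t / 2| ≤ 2 * |t| := by
    rw [abs_div, abs_mul, abs_of_pos Real.pi_pos, abs_two]
    nlinarith [Real.pi_le_four, abs_nonneg t]
  have hcosh : Real.cosh (Real.pi * t / 2) ≤ Real.exp (2 * |t|) := by
    rw [← Real.cosh_abs, Real.cosh_eq]
    have h1 := Real.exp_le_exp.2 habs
    have h2 := Real.exp_le_exp.2 (neg_le_self (abs_nonneg (Real.pi * t / 2)))
    linarith
  rw [← pow_le_pow_iff_left₀ (Real.exp_pos _).le (norm_nonneg _) two_ne_zero,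
    sq_norm_Gammaℝ_one_add_mul_I, ← Real.exp_nat_mul, Nat.cast_ofNat, mul_neg, Real.exp_neg]
  exact inv_anti₀ (Real.cosh_pos _) hcosh

/-! ### Bounds for the zeta function -/

lemma integrableOn_rpow_mul_norm_of_mellinConvergent {E : Type*} [NormedAddCommGroup E]
    [NormedSpace ℂ E] {f : ℝ → E} {a : ℝ} (hf : MellinConvergent f a) :
    IntegrableOn (fun t ↦ t ^ (a - 1) * ‖f t‖) (Ioi 0) := by
  refine IntegrableOn.congr_fun hf.norm (fun t (ht : 0 < t) ↦ ?_) measurableSet_Ioi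
  simp [norm_smul, norm_cpow_eq_rpow_re_of_pos ht]

theorem norm_mellin_le_of_re_mem_Icc {E : Type*} [NormedAddCommGroup E] [NormedSpace ℂ E]
    {f : ℝ → E} {a b : ℝ} (ha : MellinConvergent f a) (hb : MellinConvergent f b) {s : ℂ}
    (hs : s.re ∈ Icc a b) :
    ‖mellin f s‖ ≤ ∫ t in Ioi 0, (t ^ (a - 1) * ‖f t‖ + t ^ (b - 1) * ‖f t‖) := by
  have ha' := integrableOn_rpow_mul_norm_of_mellinConvergent ha
  have hb' := integrableOn_rpow_mul_norm_of_mellinConvergent hb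
  refine norm_integral_le_of_norm_le (ha'.add hb')
    ((ae_restrict_mem measurableSet_Ioi).mono fun t (ht : 0 < t) ↦ ?_)
  rw [norm_smul, norm_cpow_eq_rpow_re_of_pos ht, sub_re, one_re, ← add_mul]
  gcongr
  obtain ht1 | ht1 := le_total t 1
  · exact (Real.rpow_le_rpow_of_exponent_ge ht ht1 (by linarith [hs.1])).trans
      (le_add_of_nonneg_right (by positivity))
  · exact (Real.rpow_le_rpow_of_exponent_le ht1 (by linarith [hs.2])).trans
      (le_add_of_nonneg_left (by positivity))

theorem exists_norm_completedRiemannZeta₀_le (a b : ℝ) :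
    ∃ C : ℝ, ∀ s : ℂ, s.re ∈ Icc a b → ‖completedRiemannZeta₀ s‖ ≤ C := by
  set P := HurwitzZeta.hurwitzEvenFEPair 0
  have hconv (s : ℂ) : MellinConvergent P.f_modif s :=
    (P.isStrongFEPair_toStrongFEPair.hasMellin s).1
  refine ⟨(∫ t in Ioi 0, (t ^ (a / 2 - 1) * ‖P.f_modif t‖ + t ^ (b / 2 - 1) * ‖P.f_modif t‖)) / 2,
    fun s hs ↦ ?_⟩
  have hmellin : completedRiemannZeta₀ s = mellin P.f_modif (s / 2) / 2 := rfl
  rw [hmellin, norm_div, Complex.norm_ofNat]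
  gcongr
  refine norm_mellin_le_of_re_mem_Icc (hconv (a / 2 : ℝ)) (hconv (b / 2 : ℝ)) ?_
  rw [div_ofNat_re]
  exact ⟨by linarith [hs.1], by linarith [hs.2]⟩

lemma norm_LSeries_le_of_norm_le_one {f : ℕ → ℂ} (hf : ∀ n, ‖f n‖ ≤ 1) {x : ℝ}
    (hx : 1 < x) {s : ℂ} (hs : x ≤ s.re) :
    ‖LSeries f s‖ ≤ ∑' n : ℕ, 1 / (n : ℝ) ^ x := by
  refine tsum_of_norm_bounded (Real.summable_one_div_nat_rpow.2 hx).hasSum fun n ↦ ?_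
  obtain rfl | hn := eq_or_ne n 0
  · simpa using by positivity
  · rw [LSeries.norm_term_eq, if_neg hn]
    gcongr
    · exact hf n
    · exact_mod_cast Nat.one_le_iff_ne_zero.2 hn

lemma exists_norm_riemannZeta_mem_Icc {x : ℝ} (hx : 1 < x) :
    ∃ M : ℝ, 0 < M ∧ ∀ s : ℂ, x ≤ s.re → ‖riemannZeta s‖ ∈ Icc M⁻¹ M := by
  refine ⟨∑' n : ℕ, 1 / (n : ℝ) ^ x,
    (Real.summable_one_div_nat_rpow.2 hx).tsum_pos (fun n ↦ by positivity) 1 (by simp),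
    fun s hs ↦ ?_⟩
  have hs1 : 1 < s.re := hx.trans_le hs
  have hinv : (riemannZeta s)⁻¹ = LSeries (fun n ↦ (ArithmeticFunction.moebius n : ℂ)) s := by
    rw [← LSeries_one_eq_riemannZeta hs1]
    exact inv_eq_of_mul_eq_one_right (LSeries_one_mul_Lseries_moebius hs1)
  constructor
  · refine inv_le_of_inv_le₀ (norm_pos_iff.2 (riemannZeta_ne_zero_of_one_lt_re hs1)) ?_
    rw [← norm_inv, hinv]
    refine norm_LSeries_le_of_norm_le_one (fun n ↦ ?_) hx hs
    rw [norm_intCast]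
    exact_mod_cast ArithmeticFunction.abs_moebius_le_one (n := n)
  · rw [← LSeries_one_eq_riemannZeta hs1]
    exact norm_LSeries_le_of_norm_le_one (fun _ ↦ by simp) hx hs

/-! ### The function `ξ` -/

/-- Riemann's entire function `ξ(s) = s (s - 1) π ^ (-s / 2) Γ(s / 2) ζ(s)`, without the customary
factor `1 / 2`. It is written through the entire part of the completed zeta function, so that its
values at the removable points `0` and `1` are the correct ones. -/
noncomputable def riemannXi (s : ℂ) : ℂ := s * (s - 1) * completedRiemannZeta₀ s + 1

lemma differentiable_riemannXi : Differentiable ℂ riemannXi := by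
  have := differentiable_completedZeta₀
  unfold riemannXi
  fun_prop

lemma riemannXi_one_sub (s : ℂ) : riemannXi (1 - s) = riemannXi s := by
  rw [riemannXi, riemannXi, completedRiemannZeta₀_one_sub]
  ring

lemma riemannXi_eq_mul_riemannZeta {s : ℂ} (h0 : 0 < s.re) (h1 : s ≠ 1) :
    riemannXi s = s * (s - 1) * Gammaℝ s * riemannZeta s := by
  have hs0 : s ≠ 0 := by rintro rfl; simp at h0
  have hs1 : 1 - s ≠ 0 := sub_ne_zero.2 h1.symm
  have hG : Gammaℝ s ≠ 0 := Gammaℝ_ne_zero_of_re_pos h0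
  rw [riemannXi, riemannZeta_def_of_ne_zero hs0, completedRiemannZeta_eq]
  field_simp
  ring

lemma riemannXi_conj {s : ℂ} (h0 : 0 < s.re) : riemannXi (conj s) = conj (riemannXi s) := by
  obtain rfl | h1 := eq_or_ne s 1
  · simp [riemannXi]
  · have h1' : conj s ≠ 1 := fun h ↦ h1 (by simpa using congrArg conj h)
    rw [riemannXi_eq_mul_riemannZeta h0 h1, riemannXi_eq_mul_riemannZeta (by simpa) h1']
    simp [Gammaℝ_conj, riemannZeta_conj]

lemma norm_riemannXi_one_sub_conj {s : ℂ} (h0 : 0 < s.re) :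
    ‖riemannXi (1 - conj s)‖ = ‖riemannXi s‖ := by
  rw [riemannXi_one_sub, riemannXi_conj h0, norm_conj]

lemma riemannXi_ne_zero (hRH : RiemannHypothesis) {s : ℂ} (hs : 1 / 2 < s.re) :
    riemannXi s ≠ 0 := by
  have h0 : 0 < s.re := by linarith
  obtain rfl | h1 := eq_or_ne s 1
  · simp [riemannXi]
  have hζ : riemannZeta s ≠ 0 := fun h ↦ by
    refine hs.ne' (hRH s h ?_ h1)
    rintro ⟨n, rfl⟩
    norm_num at h0
    linarith
  rw [riemannXi_eq_mul_riemannZeta h0 h1]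
  refine mul_ne_zero (mul_ne_zero (mul_ne_zero ?_ (sub_ne_zero.2 h1))
    (Gammaℝ_ne_zero_of_re_pos h0)) hζ
  rintro rfl
  simp at h0

lemma exists_norm_riemannXi_le_exp (a b : ℝ) :
    ∃ C : ℝ, ∀ s : ℂ, s.re ∈ Icc a b → ‖riemannXi s‖ ≤ Real.exp (C + 2 * ‖s‖) := by
  obtain ⟨C, hC⟩ := exists_norm_completedRiemannZeta₀_le a b
  refine ⟨|C| + 1, fun s hs ↦ ?_⟩
  calc ‖riemannXi s‖ ≤ ‖s * (s - 1) * completedRiemannZeta₀ s‖ + ‖(1 : ℂ)‖ := norm_add_le _ _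
    _ = ‖s‖ * ‖s - 1‖ * ‖completedRiemannZeta₀ s‖ + 1 := by simp only [norm_mul, norm_one]
    _ ≤ (‖s‖ + 1) * (‖s‖ + 1) * |C| + (‖s‖ + 1) ^ 2 := by
        gcongr
        · linarith
        · simpa using norm_sub_le s 1
        · exact (hC s hs).trans (le_abs_self C)
        · exact one_le_pow₀ (by linarith [norm_nonneg s])
    _ = (|C| + 1) * (‖s‖ + 1) ^ 2 := by ring
    _ ≤ Real.exp (|C| + 1) * Real.exp ‖s‖ ^ 2 := by
        gcongr
        · linarith [Real.add_one_le_exp (|C| + 1)]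
        · exact Real.add_one_le_exp _
    _ = Real.exp (|C| + 1 + 2 * ‖s‖) := by
        rw [← Real.exp_nat_mul, ← Real.exp_add, Nat.cast_ofNat]

lemma exists_exp_neg_le_norm_riemannXi_of_re_eq_three :
    ∃ b : ℝ, ∀ t : ℝ, Real.exp (-(b + |t|)) ≤ ‖riemannXi (3 + t * I)‖ := by
  obtain ⟨M, hM, hζ⟩ := exists_norm_riemannZeta_mem_Icc (x := 3) (by norm_num)
  refine ⟨Real.log (2 * Real.pi * M), fun t ↦ ?_⟩
  set s : ℂ := 3 + t * I with hs
  have hre : s.re = 3 := by simp [hs]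
  have hre1 : (1 + t * I).re = 1 := by simp
  have hGamma : Gammaℝ s = Gammaℝ (1 + t * I) * (1 + t * I) / 2 / Real.pi := by
    rw [← Gammaℝ_add_two (fun h ↦ by simp [h] at hre1), hs]
    ring_nf
  rw [riemannXi_eq_mul_riemannZeta (by linarith) (by rintro h; norm_num [h] at hre), hGamma]
  have h0 : 1 ≤ ‖s‖ := le_trans (by linarith) (re_le_norm s)
  have h1 : 1 ≤ ‖s - 1‖ := le_trans (by norm_num [hre]) (re_le_norm (s - 1))
  have h2 : 1 ≤ ‖1 + t * I‖ := hre1.ge.trans (re_le_norm _)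
  rw [neg_add, Real.exp_add, Real.exp_neg, Real.exp_log (by positivity)]
  simp only [norm_mul, norm_div, norm_real, Complex.norm_ofNat, Real.norm_of_nonneg Real.pi_pos.le]
  calc (2 * Real.pi * M)⁻¹ * Real.exp (-|t|)
      = 1 * 1 * (Real.exp (-|t|) * 1 / 2 / Real.pi) * M⁻¹ := by field_simp
    _ ≤ _ := by
      gcongr
      · exact exp_neg_abs_le_norm_Gammaℝ_one_add_mul_I t
      · exact (hζ s hre.ge).1

lemma exists_norm_riemannXi_le_mul_exp_of_mem_ball (R : ℝ) :
    ∃ A : ℝ, 0 < A ∧ ∀ t : ℝ, ∀ z ∈ Metric.ball (3 + t * I) R,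
      ‖riemannXi z‖ ≤ ‖riemannXi (3 + t * I)‖ * Real.exp (A + 3 * |t|) := by
  obtain ⟨C, hC⟩ := exists_norm_riemannXi_le_exp (3 - R) (3 + R)
  obtain ⟨b, hb⟩ := exists_exp_neg_le_norm_riemannXi_of_re_eq_three
  refine ⟨|C| + |b| + 2 * |R| + 6, by positivity, fun t z hz ↦ ?_⟩
  set c : ℂ := 3 + t * I with hc
  have hcre : c.re = 3 := by simp [hc]
  have hcn : ‖c‖ ≤ 3 + |t| := by simpa [hc] using norm_add_le (3 : ℂ) (t * I)
  have hzn : ‖z‖ ≤ ‖c‖ + |R| := by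
    linarith [norm_le_norm_add_norm_sub' z c, mem_ball_iff_norm.1 hz, le_abs_self R]
  have hzre := re_mem_Ioo_of_mem_ball hz
  rw [hcre] at hzre
  calc ‖riemannXi z‖ ≤ Real.exp (C + 2 * ‖z‖) := hC z (Ioo_subset_Icc_self hzre)
    _ ≤ Real.exp (-(b + |t|) + (|C| + |b| + 2 * |R| + 6 + 3 * |t|)) :=
        Real.exp_le_exp.2 (by linarith [le_abs_self C, le_abs_self b])
    _ ≤ ‖riemannXi c‖ * Real.exp (|C| + |b| + 2 * |R| + 6 + 3 * |t|) := by
        rw [Real.exp_add]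
        gcongr
        exact hb t

lemma exists_exp_neg_le_norm_riemannXi (hRH : RiemannHypothesis) {η : ℝ} (hη : 0 < η) :
    ∃ B : ℝ, 0 < B ∧ ∀ s : ℂ, s.re ∈ Icc (1 / 2 + η) 3 →
      Real.exp (-(B * (1 + ‖s‖))) ≤ ‖riemannXi s‖ := by
  obtain ⟨A, hA, hbound⟩ := exists_norm_riemannXi_le_mul_exp_of_mem_ball (5 / 2)
  obtain ⟨b, hb⟩ := exists_exp_neg_le_norm_riemannXi_of_re_eq_three
  refine ⟨|b| + 1 + 5 / η * (A + 3), by positivity, fun s hs ↦ ?_⟩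
  set t := s.im with ht
  set c : ℂ := 3 + t * I with hc
  have hsc : ‖s - c‖ ≤ 5 / 2 - η := by
    have : s - c = ((s.re - 3 : ℝ) : ℂ) := by
      apply Complex.ext <;> simp [hc, ht]
    rw [this, norm_real, Real.norm_eq_abs, abs_le]
    constructor <;> linarith [hs.1, hs.2]
  have hxi0 (z : ℂ) (hz : z ∈ Metric.ball c (5 / 2)) : riemannXi z ≠ 0 := by
    have hzre := (re_mem_Ioo_of_mem_ball hz).1
    exact riemannXi_ne_zero hRH (by norm_num [hc] at hzre ⊢; exact hzre)
  have hlow := norm_mul_exp_neg_le_of_forall_ball_ne_zero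
    differentiable_riemannXi.differentiableOn hxi0 (by positivity) (hbound t) (by linarith) hsc
  have hexponent : b + |t| + 2 * (A + 3 * |t|) * (5 / 2 - η) / (5 / 2 - (5 / 2 - η)) ≤
      (|b| + 1 + 5 / η * (A + 3)) * (1 + ‖s‖) := by
    have hts : |t| ≤ ‖s‖ := abs_im_le_norm s
    have hB : 2 * (A + 3 * |t|) * (5 / 2 - η) / (5 / 2 - (5 / 2 - η)) ≤
        5 / η * ((A + 3) * (1 + ‖s‖)) := by
      rw [sub_sub_cancel, div_mul_eq_mul_div]
      gcongr ?_ / _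
      nlinarith [abs_nonneg t, mul_nonneg hA.le (norm_nonneg s), mul_nonneg hA.le hη.le,
        mul_nonneg (abs_nonneg t) hη.le]
    nlinarith [le_abs_self b, mul_nonneg (abs_nonneg b) (norm_nonneg s)]
  calc Real.exp (-((|b| + 1 + 5 / η * (A + 3)) * (1 + ‖s‖)))
      ≤ Real.exp (-(b + |t|)) *
        Real.exp (-(2 * (A + 3 * |t|) * (5 / 2 - η) / (5 / 2 - (5 / 2 - η)))) := by
        rw [← Real.exp_add, ← neg_add]
        gcongr
    _ ≤ _ := by grw [hb t, hlow]

lemma exists_norm_riemannXi_le_mul_of_two_le_re : ∃ D : ℝ, 0 < D ∧ ∀ (s : ℂ) (ε : ℝ),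
    2 ≤ s.re → 0 ≤ ε → ε ≤ 2 → ‖riemannXi s‖ ≤ D * ‖riemannXi (s + ε)‖ := by
  obtain ⟨M, hM, hζ⟩ := exists_norm_riemannZeta_mem_Icc (x := 2) (by norm_num)
  obtain ⟨D, hD, hG⟩ := exists_norm_Gammaℝ_le_mul_norm_Gammaℝ_add (a := 2) (by norm_num)
  refine ⟨D * M ^ 2, by positivity, fun s ε hs hε hε2 ↦ ?_⟩
  have hre : (s + ε).re = s.re + ε := by simp
  have hne {w : ℂ} (hw : 2 ≤ w.re) : w ≠ 1 := by rintro rfl; norm_num at hw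
  have hzeta : ‖riemannZeta s‖ ≤ M ^ 2 * ‖riemannZeta (s + ε)‖ := by
    calc ‖riemannZeta s‖ ≤ M ^ 2 * M⁻¹ := by
          rw [sq, mul_inv_cancel_right₀ hM.ne']
          exact (hζ s hs).2
      _ ≤ _ := by grw [(hζ (s + ε) (by linarith)).1]
  rw [riemannXi_eq_mul_riemannZeta (by linarith) (hne hs),
    riemannXi_eq_mul_riemannZeta (by linarith) (hne (by linarith))]
  simp only [norm_mul]
  calc ‖s‖ * ‖s - 1‖ * ‖Gammaℝ s‖ * ‖riemannZeta s‖
      ≤ ‖s + ε‖ * ‖s + ε - 1‖ * (D * ‖Gammaℝ (s + ε)‖) * (M ^ 2 * ‖riemannZeta (s + ε)‖) := by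
        gcongr
        · exact norm_le_norm_add_ofReal (by linarith) hε
        · rw [add_sub_right_comm]
          exact norm_le_norm_add_ofReal (by simp; linarith) hε
        · exact hG s ε hs hε hε2
    _ = _ := by ring

lemma exists_norm_riemannXi_le_mul_exp_mul (hRH : RiemannHypothesis) {ε : ℝ} (hε : 0 < ε)
    (hε1 : ε ≤ 1) : ∃ A B : ℝ, ∀ s : ℂ, (1 - ε) / 2 ≤ s.re →
      ‖riemannXi s‖ ≤ A * Real.exp (B * ‖s‖) * ‖riemannXi (s + ε)‖ := by
  obtain ⟨D, hD, hright⟩ := exists_norm_riemannXi_le_mul_of_two_le_re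
  obtain ⟨C, hC⟩ := exists_norm_riemannXi_le_exp 0 2
  obtain ⟨B, hB, hlow⟩ := exists_exp_neg_le_norm_riemannXi hRH (η := ε / 2) (by positivity)
  refine ⟨D + Real.exp (C + 2 * B), 2 + B, fun s hs ↦ ?_⟩
  obtain hs2 | hs2 := le_total 2 s.re
  · calc ‖riemannXi s‖ ≤ D * 1 * ‖riemannXi (s + ε)‖ := by
          simpa using hright s ε hs2 hε.le (by linarith)
      _ ≤ _ := by
          gcongr
          · exact le_add_of_nonneg_right (Real.exp_pos _).le
          · exact Real.one_le_exp (by positivity)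
  · have hnorm : ‖s + ε‖ ≤ ‖s‖ + 1 := by
      grw [norm_add_le, norm_real, Real.norm_of_nonneg hε.le, hε1]
    have hre : (s + ε).re = s.re + ε := by simp
    calc ‖riemannXi s‖ ≤ Real.exp (C + 2 * ‖s‖) := hC s ⟨by linarith, hs2⟩
      _ ≤ Real.exp (C + 2 * B) * Real.exp ((2 + B) * ‖s‖) *
          Real.exp (-(B * (1 + ‖s + ε‖))) := by
          rw [← Real.exp_add, ← Real.exp_add]
          refine Real.exp_le_exp.2 ?_
          nlinarith
      _ ≤ _ := by
          gcongr
          · exact le_add_of_nonneg_left hD.le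
          · exact hlow _ ⟨by linarith, by linarith⟩

lemma norm_riemannXi_eq_norm_riemannXi_add {ε : ℝ} {s : ℂ} (hε : ε < 1)
    (hs : s.re = (1 - ε) / 2) : ‖riemannXi s‖ = ‖riemannXi (s + ε)‖ := by
  have hreflect : 1 - conj s = s + ε := by
    apply Complex.ext <;> simp
    linarith
  rw [← norm_riemannXi_one_sub_conj (by linarith), hreflect]

theorem norm_riemannXi_le_norm_riemannXi_add (hRH : RiemannHypothesis) {ε : ℝ} (hε : 0 < ε)
    (hε1 : ε < 1) {s : ℂ} (hs : (1 - ε) / 2 ≤ s.re) : ‖riemannXi s‖ ≤ ‖riemannXi (s + ε)‖ := by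
  have hpos {z : ℂ} (hz : (1 - ε) / 2 ≤ z.re) : 0 < ‖riemannXi (z + ε)‖ :=
    norm_pos_iff.2 (riemannXi_ne_zero hRH (by simp; linarith))
  obtain ⟨A, B, hgrowth⟩ := exists_norm_riemannXi_le_mul_exp_mul hRH hε hε1.le
  obtain ⟨D, -, hright⟩ := exists_norm_riemannXi_le_mul_of_two_le_re
  have hquot : ‖riemannXi s / riemannXi (s + ε)‖ ≤ 1 := by
    have hξ := differentiable_riemannXi
    refine norm_le_of_norm_le_exp_of_re_eq (f := fun z ↦ riemannXi z / riemannXi (z + ε))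
      (A := A) (B := B) (b := 2) (D := D) (fun z hz ↦ ?_) (fun z hz ↦ ?_) (fun z hz ↦ ?_)
      (fun z hz ↦ ?_) hs
    · exact DifferentiableAt.div (by fun_prop) (by fun_prop) (norm_pos_iff.1 (hpos hz))
    · rw [norm_div, div_le_iff₀ (hpos hz)]
      exact hgrowth z hz
    · rw [norm_div, div_le_iff₀ (hpos (by linarith))]
      exact hright z ε hz hε.le (by linarith)
    · rw [norm_div, norm_riemannXi_eq_norm_riemannXi_add hε1 hz]
      exact div_self_le_one _
  rwa [norm_div, div_le_one (hpos hs)] at hquot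

/-! ### The quotient of zeta values -/

theorem exists_norm_zetaQuotient_mul_le (hRH : RiemannHypothesis) : ∃ K : ℝ, 1 ≤ K ∧
    ∀ ε : ℝ, 0 < ε → ε < 1 → ∀ s : ℂ, 1 / 2 ≤ s.re → s ≠ 1 →
      ‖zetaQuotient ε s‖ * (‖s‖ * ‖s - 1‖) ≤ ‖s + ε‖ * ‖s + ε - 1‖ * (K * ‖s‖) ^ (ε / 2) := by
  obtain ⟨K, hK0, hK⟩ := exists_norm_Gammaℝ_add_le_rpow_mul (a := 1 / 2) (by norm_num)
  refine ⟨max K 1, le_max_right _ _, fun ε hε hε1 s hs hs1 ↦ ?_⟩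
  rw [zetaQuotient]
  split_ifs with h
  · rw [norm_zero, zero_mul]
    positivity
  have hre : 1 / 2 < (s + ε).re := by simp; linarith
  have hGs : 0 < ‖Gammaℝ s‖ := norm_pos_iff.2 (Gammaℝ_ne_zero_of_re_pos (by linarith))
  have hξ := norm_riemannXi_le_norm_riemannXi_add hRH hε hε1 (s := s) (by linarith)
  have hξ0 := riemannXi_ne_zero hRH hre
  rw [riemannXi_eq_mul_riemannZeta (by linarith) h] at hξ hξ0
  rw [riemannXi_eq_mul_riemannZeta (by linarith) hs1] at hξ
  simp only [norm_mul] at hξ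
  have hζ : 0 < ‖riemannZeta (s + ε)‖ := norm_pos_iff.2 (right_ne_zero_of_mul hξ0)
  rw [norm_div, div_mul_eq_mul_div, div_le_iff₀ hζ]
  refine le_of_mul_le_mul_right ?_ hGs
  calc ‖riemannZeta s‖ * (‖s‖ * ‖s - 1‖) * ‖Gammaℝ s‖
      = ‖s‖ * ‖s - 1‖ * ‖Gammaℝ s‖ * ‖riemannZeta s‖ := by ring
    _ ≤ ‖s + ε‖ * ‖s + ε - 1‖ * ‖Gammaℝ (s + ε)‖ * ‖riemannZeta (s + ε)‖ := hξ
    _ ≤ ‖s + ε‖ * ‖s + ε - 1‖ * ((max K 1 * ‖s‖) ^ (ε / 2) * ‖Gammaℝ s‖) *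
        ‖riemannZeta (s + ε)‖ := by
      grw [hK s ε hs hε.le (by linarith), ← le_max_left K 1]
    _ = _ := by ring

lemma sq_norm_add_mul_norm_add_sub_one_le {s : ℂ} (hs : s.re = 1 / 2) {ε : ℝ} (hε : 0 ≤ ε)
    (hε1 : ε ≤ 1) :
    (‖s + ε‖ * ‖s + ε - 1‖) ^ 2 ≤ Real.exp (8 * ε) * (‖s‖ * ‖s - 1‖) ^ 2 := by
  set A := s.im ^ 2 + 1 / 4 with hA
  have hA4 : 1 / 4 ≤ A := by linarith [sq_nonneg s.im]
  have hs0 : ‖s‖ ^ 2 = A := by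
    rw [Complex.sq_norm, normSq_apply, hs, hA]
    ring
  have hs1 : ‖s - 1‖ ^ 2 = A := by
    rw [Complex.sq_norm, normSq_apply, sub_re, sub_im, hs, one_re, one_im, hA]
    ring
  have hpoly : (A + ε + ε ^ 2) * (A - ε + ε ^ 2) ≤ (8 * ε + 1) * (A * A) := by
    have hε2 : ε ^ 2 ≤ ε := by nlinarith
    have hε4 : ε ^ 2 * ε ^ 2 ≤ ε ^ 2 := mul_le_of_le_one_right (sq_nonneg _) (by linarith)
    have hA2 : ε ^ 2 * (2 * A) ≤ ε * (8 * (A * A)) :=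
      mul_le_mul hε2 (by nlinarith [hA4]) (by positivity) hε
    linarith
  rw [add_sub_right_comm, mul_pow, mul_pow, sq_norm_add_ofReal, sq_norm_add_ofReal, hs0, hs1,
    sub_re, hs, one_re]
  calc _ = (A + ε + ε ^ 2) * (A - ε + ε ^ 2) := by ring
    _ ≤ (8 * ε + 1) * (A * A) := hpoly
    _ ≤ _ := by grw [Real.add_one_le_exp]

theorem exists_sq_norm_zetaQuotient_le (hRH : RiemannHypothesis) : ∃ K : ℝ, 1 ≤ K ∧
    ∀ ε : ℝ, 0 < ε → ε < 1 → ∀ s : ℂ, s.re = 1 / 2 →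
      ‖zetaQuotient ε s‖ ^ 2 ≤ (K * ‖s‖) ^ ε := by
  obtain ⟨K, hK1, hK⟩ := exists_norm_zetaQuotient_mul_le hRH
  refine ⟨Real.exp 8 * K, one_le_mul_of_one_le_of_one_le (Real.one_le_exp (by norm_num)) hK1,
    fun ε hε hε1 s hs ↦ ?_⟩
  have hs0 : s ≠ 0 := by rintro rfl; norm_num at hs
  have hs1 : s - 1 ≠ 0 := by
    rw [sub_ne_zero]
    rintro rfl
    norm_num at hs
  have hx : 0 ≤ K * ‖s‖ := by positivity
  refine le_of_mul_le_mul_right ?_ (a := (‖s‖ * ‖s - 1‖) ^ 2) (by positivity)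
  calc ‖zetaQuotient ε s‖ ^ 2 * (‖s‖ * ‖s - 1‖) ^ 2
      = (‖zetaQuotient ε s‖ * (‖s‖ * ‖s - 1‖)) ^ 2 := (mul_pow _ _ 2).symm
    _ ≤ (‖s + ε‖ * ‖s + ε - 1‖ * (K * ‖s‖) ^ (ε / 2)) ^ 2 := by
        grw [hK ε hε hε1 s hs.ge (sub_ne_zero.1 hs1)]
    _ = (‖s + ε‖ * ‖s + ε - 1‖) ^ 2 * (K * ‖s‖) ^ ε := by
        rw [mul_pow, ← Real.rpow_mul_natCast hx, Nat.cast_ofNat, div_mul_cancel₀ ε two_ne_zero]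
    _ ≤ Real.exp (8 * ε) * (‖s‖ * ‖s - 1‖) ^ 2 * (K * ‖s‖) ^ ε := by
        grw [sq_norm_add_mul_norm_add_sub_one_le hs hε.le hε1.le]
    _ = (Real.exp 8 * K * ‖s‖) ^ ε * (‖s‖ * ‖s - 1‖) ^ 2 := by
        rw [mul_assoc (Real.exp 8), Real.mul_rpow (Real.exp_pos _).le hx, ← Real.exp_mul]
        ring

theorem exists_sq_norm_zetaQuotient_le_mul_rpow (hRH : RiemannHypothesis) :
    ∃ C : ℝ, 0 < C ∧ ∀ ε : ℝ, 0 < ε → ε < 1 → ∀ s : ℂ, s.re = 1 / 2 →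
      ‖zetaQuotient ε s‖ ^ 2 ≤ C * ‖s‖ ^ ε := by
  obtain ⟨K, hK1, hK⟩ := exists_sq_norm_zetaQuotient_le hRH
  exact ⟨K, by positivity, fun ε hε hε1 s hs ↦
    (hK ε hε hε1 s hs).trans (mul_rpow_le_mul_rpow hK1 (norm_nonneg s) hε1.le)⟩

theorem exists_sq_norm_zetaQuotient_le_one_add (hRH : RiemannHypothesis) :
    ∃ C : ℝ, 0 < C ∧ ∀ ε p : ℝ, 0 < ε → ε < 1 → ε ≤ p → p ≤ 1 → ∀ s : ℂ, s.re = 1 / 2 →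
      ‖zetaQuotient ε s‖ ^ 2 ≤ 1 + C * (ε / p * ‖s‖ ^ p) := by
  obtain ⟨K, hK1, hK⟩ := exists_sq_norm_zetaQuotient_le hRH
  refine ⟨K, by positivity, fun ε p hε hε1 hεp hp1 s hs ↦ ?_⟩
  have hεp0 : 0 ≤ ε / p := div_nonneg hε.le (hε.le.trans hεp)
  calc ‖zetaQuotient ε s‖ ^ 2 ≤ (K * ‖s‖) ^ ε := hK ε hε hε1 s hs
    _ ≤ 1 + ε / p * (K * ‖s‖) ^ p := rpow_le_one_add_div_mul_rpow (by positivity) hε hεp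
    _ ≤ 1 + ε / p * (K * ‖s‖ ^ p) := by grw [mul_rpow_le_mul_rpow hK1 (norm_nonneg s) hp1]
    _ = 1 + K * (ε / p * ‖s‖ ^ p) := by ring

theorem exists_norm_zetaQuotient_div_le (hRH : RiemannHypothesis) :
    ∃ C : ℝ, 0 < C ∧ ∀ ε : ℝ, 0 < ε → ε < 1 → ∀ s : ℂ, 1 / 2 ≤ s.re → s ≠ 1 →
      ‖zetaQuotient ε s / (s * (1 - s))‖ ≤ C * (‖s‖ ^ (ε / 2) / ‖s - 1‖ ^ 2) := by
  obtain ⟨K, hK1, hK⟩ := exists_norm_zetaQuotient_mul_le hRH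
  refine ⟨9 * K, by positivity, fun ε hε hε1 s hs hs1 ↦ ?_⟩
  have hs_half : 1 / 2 ≤ ‖s‖ := hs.trans (re_le_norm s)
  have hs0 : 0 < ‖s‖ := by linarith
  have hs1' : 0 < ‖s - 1‖ := norm_pos_iff.2 (sub_ne_zero.2 hs1)
  have hadd : ‖s + ε‖ ≤ 3 * ‖s‖ := by
    grw [norm_add_le, norm_real, Real.norm_of_nonneg hε.le]
    linarith
  have hsub : ‖s + ε - 1‖ ≤ 3 * ‖s‖ := by
    have : s + ε - 1 = s + ((ε - 1 : ℝ) : ℂ) := by push_cast; ring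
    grw [this, norm_add_le, norm_real, Real.norm_of_nonpos (by linarith)]
    linarith
  have hquot : ‖zetaQuotient ε s‖ * (‖s‖ * ‖s - 1‖) ≤
      3 * ‖s‖ * (3 * ‖s‖) * (K * ‖s‖ ^ (ε / 2)) := by
    grw [hK ε hε hε1 s hs hs1, hadd, hsub,
      mul_rpow_le_mul_rpow hK1 hs0.le (p := ε / 2) (by linarith)]
  rw [norm_div, norm_mul, norm_sub_rev 1 s, mul_div_assoc', div_le_div_iff₀ (by positivity)
    (by positivity)]
  refine le_of_mul_le_mul_left ?_ hs0
  calc ‖s‖ * (‖zetaQuotient ε s‖ * ‖s - 1‖ ^ 2)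
      = ‖zetaQuotient ε s‖ * (‖s‖ * ‖s - 1‖) * ‖s - 1‖ := by ring
    _ ≤ 3 * ‖s‖ * (3 * ‖s‖) * (K * ‖s‖ ^ (ε / 2)) * ‖s - 1‖ := by grw [hquot]
    _ = _ := by ring

theorem proposition4_general (hRH : RiemannHypothesis) :
    (∃ C : ℝ, 0 < C ∧ ∀ ε : ℝ, 0 < ε → ε < 1 → ∀ s : ℂ, s.re = 1 / 2 →
      ‖zetaQuotient ε s‖ ^ 2 ≤ C * ‖s‖ ^ ε) ∧
    (∃ C : ℝ, 0 < C ∧ ∀ ε p : ℝ, 0 < ε → ε < 1 → ε ≤ p → p ≤ 1 → ∀ s : ℂ, s.re = 1 / 2 →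
      ‖zetaQuotient ε s‖ ^ 2 ≤ 1 + C * (ε / p * ‖s‖ ^ p)) ∧
    (∃ C : ℝ, 0 < C ∧ ∀ ε : ℝ, 0 < ε → ε < 1 → ∀ s : ℂ, 1 / 2 ≤ s.re → s ≠ 1 →
      ‖zetaQuotient ε s / (s * (1 - s))‖ ≤ C * (‖s‖ ^ (ε / 2) / ‖s - 1‖ ^ 2)) :=
  ⟨exists_sq_norm_zetaQuotient_le_mul_rpow hRH, exists_sq_norm_zetaQuotient_le_one_add hRH,
    exists_norm_zetaQuotient_div_le hRH⟩

theorem proposition4 (hRH : RiemannHypothesis) :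
    (∃ C : ℝ, 0 < C ∧ ∀ ε : ℝ, 0 < ε → ε ≤ 1 / 2 → ∀ s : ℂ, s.re = 1 / 2 →
      ‖zetaQuotient ε s‖ ^ 2 ≤ C * ‖s‖ ^ ε) ∧
    (∃ C : ℝ, 0 < C ∧ ∀ ε : ℝ, 0 < ε → ε ≤ 1 / 2 → ∀ s : ℂ, s.re = 1 / 2 →
      ‖zetaQuotient ε s‖ ^ 2 ≤ 1 + C * (ε * ‖s‖ ^ (1 / 2 : ℝ))) ∧
    (∃ C : ℝ, 0 < C ∧ ∀ ε : ℝ, 0 < ε → ε ≤ 1 / 2 → ∀ s : ℂ, 1 / 2 ≤ s.re → s ≠ 1 →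
      ‖zetaQuotient ε s / (s * (1 - s))‖ ≤ C * (‖s‖ ^ (ε / 2) / ‖s - 1‖ ^ 2)) := by
  obtain ⟨⟨C₁, hC₁, h₁⟩, ⟨C₂, hC₂, h₂⟩, ⟨C₃, hC₃, h₃⟩⟩ := proposition4_general hRH
  exact ⟨⟨C₁, hC₁, fun ε hε hε1 ↦ h₁ ε hε (by linarith)⟩,
    ⟨2 * C₂, by positivity, fun ε hε hε1 s hs ↦
      (h₂ ε (1 / 2) hε (by linarith) hε1 (by norm_num) s hs).trans_eq (by ring)⟩,
    ⟨C₃, hC₃, fun ε hε hε1 ↦ h₃ ε hε (by linarith)⟩⟩
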